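/- Let $W=(W^1,\dots,W^d)$ be a standard $d$-dimensional Brownian motion, let $0\le s\le t$ and $h:=t-s$, and write $W_{s,u}:=W_u-W_s$. Define the path increment $W_{s,t}=W_t-W_s$, the (rescaled) space-time Lévy area $$H_{s,t}:=\frac1h\int_s^t\Big(W_{s,u}-\frac{u-s}{h}W_{s,t}\Big)\,du$$ and the (rescaled) space-time-time Lévy area $$K_{s,t}:=\frac1{h^2}\int_s^t\Big(W_{s,u}-\frac{u-s}{h}W_{s,t}\Big)\Big(\frac12h-(u-s)\Big)\,du,$$ with $H_{s,t}=K_{s,t}:=0$ if $s=t$. Then the following iterated integrals (Itô integrals, with continuous versions, for $dW$, and pathwise Lebesgue integrals for $dr$, $dv$, $du$; taken in each coordinate of $W$) exist, and almost surely $$\int_s^t dW_u=W_{s,t},$$ $$\int_s^t\int_s^u dW_v\,du=\tfrac12hW_{s,t}+hH_{s,t},$$ $$\int_s^t\int_s^u dv\,dW_u=\tfrac12hW_{s,t}-hH_{s,t},$$ $$\int_s^t\int_s^u\int_s^v dW_r\,dv\,du=\tfrac16h^2W_{s,t}+\tfrac12h^2H_{s,t}+h^2K_{s,t},$$ $$\int_s^t\int_s^u\int_s^v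 dr\,dW_v\,du=\tfrac16h^2W_{s,t}-2h^2K_{s,t},$$ $$\int_s^t\int_s^u\int_s^v dr\,dv\,dW_u=\tfrac16h^2W_{s,t}-\tfrac12h^2H_{s,t}+h^2K_{s,t}.$$ -/

import Mathlib

open MeasureTheory ProbabilityTheory Filter Topology
open scoped NNReal ENNReal

noncomputable section

/-- `W` is a standard `d`-dimensional Brownian motion on `(Ω, P)`: each `W t` is a random vector,
each coordinate process is a real Brownian motion, and the coordinate processes are independent. -/
structure IsStandardBrownianMotion {Ω : Type*} [MeasurableSpace Ω] {d : ℕ}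
    (W : ℝ≥0 → Ω → EuclideanSpace ℝ (Fin d)) (P : Measure Ω) : Prop where
  measurable : ∀ t, Measurable (W t)
  isBrownianReal : ∀ i, IsBrownianReal (fun t ω ↦ W t ω i) P
  indep : iIndepFun (fun (i : Fin d) (ω : Ω) (t : ℝ≥0) ↦ W t ω i) P

/-- The natural filtration `σ(W u : u ≤ t)` of a Brownian motion. -/
def IsStandardBrownianMotion.filtration {Ω : Type*} {m : MeasurableSpace Ω} {d : ℕ}
    {W : ℝ≥0 → Ω → EuclideanSpace ℝ (Fin d)} {P : Measure Ω}
    (hW : IsStandardBrownianMotion W P) : Filtration ℝ≥0 m :=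
  Filtration.natural W fun t ↦ (hW.measurable t).stronglyMeasurable

/-! ### The Itô integral -/

/-- A simple (elementary) process on `(s, t]`: the process
`∑ k < n, coeff k * 1_{(time k, time (k + 1)]}` with times in `[s, t]` and with bounded
coefficients such that `coeff k` is `𝓕 (time k)`-measurable. -/
structure ItoSimpleProcess {Ω : Type*} {m : MeasurableSpace Ω} (𝓕 : Filtration ℝ≥0 m)
    (s t : ℝ≥0) where
  n : ℕ
  time : ℕ → ℝ≥0
  time_mono : Monotone time
  time_mem : ∀ k, time k ∈ Set.Icc s t
  coeff : ℕ → Ω → ℝ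
  coeff_measurable : ∀ k, Measurable[𝓕 (time k)] (coeff k)
  coeff_bounded : ∀ k, ∃ C : ℝ, ∀ ω, |coeff k ω| ≤ C

/-- The value of a simple process at time `u`. -/
def ItoSimpleProcess.eval {Ω : Type*} {m : MeasurableSpace Ω} {𝓕 : Filtration ℝ≥0 m}
    {s t : ℝ≥0} (φ : ItoSimpleProcess 𝓕 s t) (u : ℝ≥0) (ω : Ω) : ℝ :=
  ∑ k ∈ Finset.range φ.n,
    (Set.Ioc (φ.time k) (φ.time (k + 1))).indicator (fun _ ↦ φ.coeff k ω) u

/-- The Itô integral `∑ k < n, coeff k * (B (time (k + 1)) - B (time k))` of a simple process. -/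
def ItoSimpleProcess.integral {Ω : Type*} {m : MeasurableSpace Ω} {𝓕 : Filtration ℝ≥0 m}
    {s t : ℝ≥0} (φ : ItoSimpleProcess 𝓕 s t) (B : ℝ≥0 → Ω → ℝ) (ω : Ω) : ℝ :=
  ∑ k ∈ Finset.range φ.n, φ.coeff k ω * (B (φ.time (k + 1)) ω - B (φ.time k) ω)

/-- `Y = ∫_s^t X_u dB_u` in the sense of Itô: `X` is square integrable on `(s, t] × Ω` and there
are simple processes `φ n` converging to `X` in `L²((s, t] × Ω)` whose integrals converge to `Y`
in `L²(Ω)`. -/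
def IsItoIntegral {Ω : Type*} {m : MeasurableSpace Ω} (P : Measure Ω) (𝓕 : Filtration ℝ≥0 m)
    (B X : ℝ≥0 → Ω → ℝ) (s t : ℝ≥0) (Y : Ω → ℝ) : Prop :=
  MemLp (fun p : ℝ × Ω ↦ X p.1.toNNReal p.2) 2 ((volume.restrict (Set.Ioc (s : ℝ) t)).prod P) ∧
  MemLp Y 2 P ∧
  ∃ φ : ℕ → ItoSimpleProcess 𝓕 s t,
    Tendsto (fun n ↦ eLpNorm
      (fun p : ℝ × Ω ↦ (φ n).eval p.1.toNNReal p.2 - X p.1.toNNReal p.2) 2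
      ((volume.restrict (Set.Ioc (s : ℝ) t)).prod P)) atTop (𝓝 0) ∧
    Tendsto (fun n ↦ eLpNorm (fun ω ↦ (φ n).integral B ω - Y ω) 2 P) atTop (𝓝 0)

/-- `J` is a version of the process `t ↦ ∫_s^t X_u dB_u`, `t ≥ s`, with almost surely
continuous paths. -/
def IsItoIntegralProcess {Ω : Type*} {m : MeasurableSpace Ω} (P : Measure Ω)
    (𝓕 : Filtration ℝ≥0 m) (B X : ℝ≥0 → Ω → ℝ) (s : ℝ≥0) (J : ℝ≥0 → Ω → ℝ) : Prop :=
  (∀ᵐ ω ∂P, ContinuousOn (fun t ↦ J t ω) (Set.Ici s)) ∧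
  ∀ t, s ≤ t → IsItoIntegral P 𝓕 B X s t (J t)

/-- `J` is the process `t ↦ ∫_s^t X_u du`, `t ≥ s`, computed path by path. -/
def IsTimeIntegralProcess {Ω : Type*} {m : MeasurableSpace Ω} (P : Measure Ω)
    (X : ℝ≥0 → Ω → ℝ) (s : ℝ≥0) (J : ℝ≥0 → Ω → ℝ) : Prop :=
  ∀ᵐ ω ∂P, ∀ t, s ≤ t → IntervalIntegrable (fun u : ℝ ↦ X u.toNNReal ω) volume s t ∧
    J t ω = ∫ u in (s : ℝ)..t, X u.toNNReal ω

/-! ### The signature of space-time Brownian motion `(t, W t)` -/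

/-- The coordinates of space-time Brownian motion: time and the `d` coordinates of `W`. -/
inductive SpaceTimeLetter (d : ℕ) where
  | time : SpaceTimeLetter d
  | space (i : Fin d) : SpaceTimeLetter d

/-- Auxiliary recursion for `IsIteratedIntegral`, in which the head of the list is the
outermost integrator. -/
def IsIteratedIntegralRev {Ω : Type*} {m : MeasurableSpace Ω} {d : ℕ} (P : Measure Ω)
    (𝓕 : Filtration ℝ≥0 m) (W : ℝ≥0 → Ω → EuclideanSpace ℝ (Fin d)) (s : ℝ≥0) :
    List (SpaceTimeLetter d) → (ℝ≥0 → Ω → ℝ) → Prop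
  | [], J => ∀ t ω, J t ω = 1
  | .time :: w, J =>
      ∃ X, IsIteratedIntegralRev P 𝓕 W s w X ∧ IsTimeIntegralProcess P X s J
  | .space i :: w, J =>
      ∃ X, IsIteratedIntegralRev P 𝓕 W s w X ∧
        IsItoIntegralProcess P 𝓕 (fun t ω ↦ W t ω i) X s J

/-- `J` is the process `t ↦ ∫_{s ≤ u₁ ≤ ⋯ ≤ uₙ ≤ t} dZ^{w₁}_{u₁} ⋯ dZ^{wₙ}_{uₙ}`, `t ≥ s`, of
iterated integrals of `Z = (t, W t)` along the word `w = [w₁, …, wₙ]` (`w₁` innermost). -/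
def IsIteratedIntegral {Ω : Type*} {m : MeasurableSpace Ω} {d : ℕ} (P : Measure Ω)
    (𝓕 : Filtration ℝ≥0 m) (W : ℝ≥0 → Ω → EuclideanSpace ℝ (Fin d)) (s : ℝ≥0)
    (w : List (SpaceTimeLetter d)) (J : ℝ≥0 → Ω → ℝ) : Prop :=
  IsIteratedIntegralRev P 𝓕 W s w.reverse J

/-- The iterated integral of `(t, W t)` over `[s, t]` along the word `w` exists, and (whatever
versions of the stochastic integrals are used) it is almost surely equal to `Y`. -/
def IteratedIntegralEq {Ω : Type*} {m : MeasurableSpace Ω} {d : ℕ} (P : Measure Ω)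
    (𝓕 : Filtration ℝ≥0 m) (W : ℝ≥0 → Ω → EuclideanSpace ℝ (Fin d)) (s t : ℝ≥0)
    (w : List (SpaceTimeLetter d)) (Y : Ω → ℝ) : Prop :=
  (∃ J, IsIteratedIntegral P 𝓕 W s w J) ∧
  ∀ J, IsIteratedIntegral P 𝓕 W s w J → ∀ᵐ ω ∂P, J t ω = Y ω

/-! ### Increment and Lévy areas -/

/-- The path increment `W_{s,t} = W_t - W_s`. -/
def pathIncrement {Ω : Type*} {d : ℕ} (W : ℝ≥0 → Ω → EuclideanSpace ℝ (Fin d)) (s t : ℝ≥0)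
    (ω : Ω) : EuclideanSpace ℝ (Fin d) :=
  W t ω - W s ω

/-- The Brownian bridge `W_{s,u} - ((u - s) / h) W_{s,t}` on `[s, t]`, where `h = t - s`. -/
def brownianBridge {Ω : Type*} {d : ℕ} (W : ℝ≥0 → Ω → EuclideanSpace ℝ (Fin d)) (s t : ℝ≥0)
    (u : ℝ) (ω : Ω) : EuclideanSpace ℝ (Fin d) :=
  pathIncrement W s u.toNNReal ω - ((u - s) / ((t : ℝ) - s)) • pathIncrement W s t ω

/-- The (rescaled) space-time Lévy area `H_{s,t}`. -/
def spaceTimeLevyArea {Ω : Type*} {d : ℕ} (W : ℝ≥0 → Ω → EuclideanSpace ℝ (Fin d)) (s t : ℝ≥0)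
    (ω : Ω) : EuclideanSpace ℝ (Fin d) :=
  (1 / ((t : ℝ) - s)) • ∫ u in (s : ℝ)..t, brownianBridge W s t u ω

/-- The (rescaled) space-time-time Lévy area `K_{s,t}`. -/
def spaceTimeTimeLevyArea {Ω : Type*} {d : ℕ} (W : ℝ≥0 → Ω → EuclideanSpace ℝ (Fin d))
    (s t : ℝ≥0) (ω : Ω) : EuclideanSpace ℝ (Fin d) :=
  (1 / ((t : ℝ) - s) ^ 2) •
    ∫ u in (s : ℝ)..t, (1 / 2 * ((t : ℝ) - s) - (u - s)) • brownianBridge W s t u ω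

end

/-!
The argument reduces every iterated integral to explicit functionals of a continuous path.

The Itô integrals that occur have deterministic integrands: `1`, `u - s` and `(u - s) ^ 2 / 2`, up
to null sets. For a `C¹` function `f` the Itô integral `∫_s^t f dB` is
`f(t) B_t - f(s) B_s - ∫_s^t f'(u) B_u du` (`wienerIntegral`). Existence
(`IsBrownianRelativeTo.isItoIntegral_wienerIntegral`): the integrals of step functions approximating
`f` converge to this expression along every continuous path, by summation by parts, and they are
Cauchy in `L²` by the Itô isometry, so the convergence also holds in `L²`. Uniqueness
(`IsItoIntegral.ae_eq`) is the Itô isometry again, for the difference of two simple processes, and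
continuity of paths turns equality at each time into equality at all times
(`IsItoIntegralProcess.ae_forall_eq_wienerIntegral`). The isometry is available because a coordinate
of `W` is a Brownian motion relative to the filtration of all of `W`
(`IsStandardBrownianMotion.isBrownianRelativeTo`).

Going through a word letter by letter (`HasIteratedIntegralRev`), each of the six integrals becomes
a combination of `W_s`, `W_t`, `∫ W_u du` and `∫ (u - s) W_u du`. The Lévy areas `H` and `K` are
combinations of the same quantities (`mul_spaceTimeLevyArea_apply`,
`sq_mul_spaceTimeTimeLevyArea_apply`), and the identities follow by linear algebra.
-/

/-! ### Brownian motion relative to a filtration -/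

/-- `B` is a real Brownian motion relative to the filtration `𝓕`: it is adapted to `𝓕`, and for
every `a` the shifted process `u ↦ B (a + u) - B a` is independent of `𝓕 a`. -/
structure IsBrownianRelativeTo {Ω : Type*} {m : MeasurableSpace Ω} (𝓕 : Filtration ℝ≥0 m)
    (B : ℝ≥0 → Ω → ℝ) (P : Measure Ω) : Prop where
  isBrownianReal : IsBrownianReal B P
  adapted : ∀ u, Measurable[𝓕 u] (B u)
  indep : ∀ a, Indep (MeasurableSpace.comap (fun ω u ↦ B (a + u) ω - B a ω)
    (inferInstance : MeasurableSpace (ℝ≥0 → ℝ))) (𝓕 a) P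

/-- If `m₁` is independent of `m₂`, and `m₃` is independent of both jointly, then `m₁` is
independent of `m₂ ⊔ m₃`. -/
theorem indep_sup_right_of_indep_sup_left {Ω : Type*} {m : MeasurableSpace Ω} {P : Measure Ω}
    [IsProbabilityMeasure P] {m₁ m₂ m₃ : MeasurableSpace Ω} (h₁ : m₁ ≤ m) (h₂ : m₂ ≤ m)
    (h₃ : m₃ ≤ m) (h : Indep m₁ m₂ P) (h' : Indep (m₁ ⊔ m₂) m₃ P) : Indep m₁ (m₂ ⊔ m₃) P := by
  have key : Indep (MeasurableSpace.generateFrom {A | MeasurableSet[m₁] A})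
      (MeasurableSpace.generateFrom
        (Set.image2 (· ∩ ·) {A | MeasurableSet[m₂] A} {A | MeasurableSet[m₃] A})) P := by
    refine IndepSets.indep' (fun A hA ↦ h₁ A hA) ?_ (@MeasurableSpace.isPiSystem_measurableSet _ m₁)
      ?_ ?_
    · rintro _ ⟨A, hA, C, hC, rfl⟩
      exact (h₂ A hA).inter (h₃ C hC)
    · rintro _ ⟨A, hA, C, hC, rfl⟩ _ ⟨A', hA', C', hC', rfl⟩ -
      exact ⟨A ∩ A', @MeasurableSet.inter _ m₂ _ _ hA hA', C ∩ C',
        @MeasurableSet.inter _ m₃ _ _ hC hC', Set.inter_inter_inter_comm _ _ _ _⟩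
    · rw [IndepSets_iff]
      rintro D _ hD ⟨A, hA, C, hC, rfl⟩
      have hDA : MeasurableSet[m₁ ⊔ m₂] (D ∩ A) :=
        @MeasurableSet.inter _ (m₁ ⊔ m₂) _ _ ((le_sup_left : m₁ ≤ m₁ ⊔ m₂) D hD)
          ((le_sup_right : m₂ ≤ m₁ ⊔ m₂) A hA)
      have hA' : MeasurableSet[m₁ ⊔ m₂] A := (le_sup_right : m₂ ≤ m₁ ⊔ m₂) A hA
      show P (D ∩ (A ∩ C)) = P D * P (A ∩ C)
      rw [← Set.inter_assoc, (Indep_iff _ _ _).1 h' _ _ hDA hC, (Indep_iff _ _ _).1 h _ _ hD hA,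
        (Indep_iff _ _ _).1 h' _ _ hA' hC, mul_assoc]
  refine indep_of_indep_of_le key (fun A hA ↦ MeasurableSpace.measurableSet_generateFrom hA) ?_
  refine sup_le (fun A hA ↦ MeasurableSpace.measurableSet_generateFrom ?_)
    (fun A hA ↦ MeasurableSpace.measurableSet_generateFrom ?_)
  · exact ⟨A, hA, Set.univ, @MeasurableSet.univ _ m₃, Set.inter_univ A⟩
  · exact ⟨Set.univ, @MeasurableSet.univ _ m₂, A, hA, Set.univ_inter A⟩

/-- The coordinates of a standard Brownian motion `W` are Brownian motions relative to the natural
filtration of all of `W`: besides the weak Markov property of the coordinate itself, this uses the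
independence of the coordinates. -/
theorem IsStandardBrownianMotion.isBrownianRelativeTo {Ω : Type*} {mΩ : MeasurableSpace Ω}
    {P : Measure Ω} [IsProbabilityMeasure P] {d : ℕ} {W : ℝ≥0 → Ω → EuclideanSpace ℝ (Fin d)}
    (hW : IsStandardBrownianMotion W P) (i : Fin d) :
    IsBrownianRelativeTo hW.filtration (fun t ω ↦ W t ω i) P where
  isBrownianReal := hW.isBrownianReal i
  adapted u := by
    have h : Measurable[hW.filtration u] (W u) := by
      rw [measurable_iff_comap_le]
      exact le_iSup₂ (f := fun j (_ : j ≤ u) ↦ MeasurableSpace.comap (W j) _) u le_rfl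
    exact (by fun_prop : Measurable fun x : EuclideanSpace ℝ (Fin d) ↦ x i).comp h
  indep a := by
    have hWm (j : Fin d) (t : ℝ≥0) : Measurable fun ω ↦ W t ω j :=
      (by fun_prop : Measurable fun x : EuclideanSpace ℝ (Fin d) ↦ x j).comp (hW.measurable t)
    set σ : Fin d → MeasurableSpace Ω := fun j ↦
      MeasurableSpace.comap (fun ω (t : ℝ≥0) ↦ W t ω j) inferInstance with hσ
    have hσm j : σ j ≤ mΩ :=
      measurable_iff_comap_le.1 (measurable_pi_lambda _ fun t ↦ hWm j t)
    have hσmeas j t : Measurable[σ j] fun ω ↦ W t ω j :=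
      (measurable_pi_apply t).comp (comap_measurable (fun ω (t : ℝ≥0) ↦ W t ω j))
    set future : ℝ≥0 → MeasurableSpace Ω := fun a ↦ MeasurableSpace.comap
      (fun ω (u : ℝ≥0) ↦ W (a + u) ω i - W a ω i) inferInstance
    set past : ℝ≥0 → MeasurableSpace Ω := fun a ↦ MeasurableSpace.comap
      (fun ω (u : Set.Iic a) ↦ W u ω i) inferInstance
    have hfuture : future a ≤ σ i := measurable_iff_comap_le.1 <|
      @measurable_pi_lambda _ _ _ (σ i) _ _ fun u ↦ (hσmeas i _).sub (hσmeas i a)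
    have hpast : past a ≤ σ i := measurable_iff_comap_le.1 <|
      @measurable_pi_lambda _ _ _ (σ i) _ _ fun u ↦ hσmeas i _
    have hothers : (⨆ j ∈ ({i}ᶜ : Set (Fin d)), σ j) ≤ mΩ :=
      iSup₂_le fun j _ ↦ hσm j
    have h₁ : Indep (future a) (past a) P :=
      (hW.isBrownianReal i).toIsPreBrownianReal.indepFun_shift a
    have h₂ : Indep (σ i) (⨆ j ∈ ({i}ᶜ : Set (Fin d)), σ j) P := by
      have := indep_iSup_of_disjoint hσm hW.indep
        (disjoint_compl_right : Disjoint ({i} : Set (Fin d)) {i}ᶜ)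
      simpa using this
    refine indep_of_indep_of_le_right (indep_sup_right_of_indep_sup_left (hfuture.trans (hσm i))
      (hpast.trans (hσm i)) hothers h₁
      (indep_of_indep_of_le_left h₂ (sup_le hfuture hpast))) ?_
    refine iSup₂_le fun u hu ↦ ?_
    rw [← measurable_iff_comap_le]
    have hcoord : Measurable[past a ⊔ ⨆ j ∈ ({i}ᶜ : Set (Fin d)), σ j] fun ω j ↦ W u ω j := by
      refine @measurable_pi_lambda _ _ _ (past a ⊔ ⨆ j ∈ ({i}ᶜ : Set (Fin d)), σ j) _ _ fun j ↦ ?_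
      by_cases hj : j = i
      · subst hj
        have : Measurable[past a] fun ω ↦ W u ω j :=
          (measurable_pi_apply (⟨u, hu⟩ : Set.Iic a)).comp
            (comap_measurable (fun ω (u : Set.Iic a) ↦ W u ω j))
        exact this.mono le_sup_left le_rfl
      · exact (hσmeas j u).mono (le_sup_of_le_right (le_iSup₂_of_le j hj le_rfl)) le_rfl
    exact (WithLp.measurable_toLp 2 (Fin d → ℝ)).comp hcoord

namespace IsBrownianRelativeTo

variable {Ω : Type*} {m : MeasurableSpace Ω} {𝓕 : Filtration ℝ≥0 m} {B : ℝ≥0 → Ω → ℝ}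
  {P : Measure Ω}

theorem memLp_sub (hB : IsBrownianRelativeTo 𝓕 B P) (a b : ℝ≥0) :
    MemLp (fun ω ↦ B b ω - B a ω) 2 P :=
  (hB.isBrownianReal.isGaussianProcess.hasGaussianLaw_eval b).memLp_two.sub
    (hB.isBrownianReal.isGaussianProcess.hasGaussianLaw_eval a).memLp_two

theorem indepFun_of_measurable_shift (hB : IsBrownianRelativeTo 𝓕 B P) {a : ℝ≥0} {M : Ω → ℝ}
    (hM : Measurable[𝓕 a] M) {F : (ℝ≥0 → ℝ) → ℝ} (hF : Measurable F) :
    IndepFun M (fun ω ↦ F fun u ↦ B (a + u) ω - B a ω) P := by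
  rw [IndepFun_iff_Indep]
  refine indep_of_indep_of_le (hB.indep a).symm (measurable_iff_comap_le.1 hM) ?_
  exact measurable_iff_comap_le.1 (hF.comp (comap_measurable _))

theorem integral_mul_sub_eq_zero (hB : IsBrownianRelativeTo 𝓕 B P) {a b : ℝ≥0} (hab : a ≤ b)
    {M : Ω → ℝ} (hM : Measurable[𝓕 a] M) : ∫ ω, M ω * (B b ω - B a ω) ∂P = 0 := by
  have h := hB.indepFun_of_measurable_shift hM (measurable_pi_apply (b - a))
  simp only [add_tsub_cancel_of_le hab] at h
  rw [h.integral_fun_mul_eq_mul_integral (hM.mono (𝓕.le a) le_rfl).aestronglyMeasurable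
    (hB.memLp_sub a b).1, integral_sub (hB.isBrownianReal.integrable_eval b)
    (hB.isBrownianReal.integrable_eval a), hB.isBrownianReal.integral_eval,
    hB.isBrownianReal.integral_eval]
  simp

theorem integral_mul_sub_mul_sub (hB : IsBrownianRelativeTo 𝓕 B P) {a b b' : ℝ≥0} (hab : a ≤ b)
    (hab' : a ≤ b') {M : Ω → ℝ} (hM : Measurable[𝓕 a] M) :
    ∫ ω, M ω * ((B b ω - B a ω) * (B b' ω - B a ω)) ∂P =
      (∫ ω, M ω ∂P) * ((min b b' : ℝ≥0) - a) := by
  have h := hB.indepFun_of_measurable_shift hM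
    ((measurable_pi_apply (b - a)).mul (measurable_pi_apply (b' - a)))
  simp only [Pi.mul_apply, add_tsub_cancel_of_le hab, add_tsub_cancel_of_le hab'] at h
  have hP := hB.isBrownianReal.isGaussianProcess.isProbabilityMeasure
  rw [h.integral_fun_mul_eq_mul_integral (hM.mono (𝓕.le a) le_rfl).aestronglyMeasurable
    ((hB.memLp_sub a b).1.mul (hB.memLp_sub a b').1)]
  congr 1
  have hcov := hB.isBrownianReal.toIsPreBrownianReal.shift a
  have h1 := hcov.covariance_eval (b - a) (b' - a)
  rw [covariance_eq_sub (hcov.isGaussianProcess.hasGaussianLaw_eval _).memLp_two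
    (hcov.isGaussianProcess.hasGaussianLaw_eval _).memLp_two, hcov.integral_eval,
    hcov.integral_eval] at h1
  simp only [Pi.mul_apply, add_tsub_cancel_of_le hab, add_tsub_cancel_of_le hab', mul_zero,
    sub_zero] at h1
  rw [h1, NNReal.coe_min, NNReal.coe_sub hab, NNReal.coe_sub hab', NNReal.coe_min,
    min_sub_sub_right]

end IsBrownianRelativeTo

/-! ### The Itô isometry and uniqueness of the Itô integral -/

theorem volume_real_Ioc_inter_Ioc {a b a' b' : ℝ} (haa' : a ≤ a') (hab' : a' ≤ b') :
    volume.real (Set.Ioc a b ∩ Set.Ioc a' b') = min (max b a') b' - a' := by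
  rw [Set.Ioc_inter_Ioc, max_eq_right haa', Real.volume_real_Ioc]
  rcases le_total b a' with h | h
  · rw [max_eq_right h, min_eq_left hab', sub_self, max_eq_right]
    linarith [min_le_left b b']
  · rw [max_eq_left h, max_eq_left]
    linarith [le_min h hab']

namespace IsBrownianRelativeTo

variable {Ω : Type*} {m : MeasurableSpace Ω} {𝓕 : Filtration ℝ≥0 m} {B : ℝ≥0 → Ω → ℝ}
  {P : Measure Ω}

theorem memLp_mul_sub (hB : IsBrownianRelativeTo 𝓕 B P) (a b : ℝ≥0) {r : ℝ≥0} {c : Ω → ℝ}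
    (hc : Measurable[𝓕 r] c) (hc' : ∃ C : ℝ, ∀ ω, |c ω| ≤ C) :
    MemLp (fun ω ↦ c ω * (B b ω - B a ω)) 2 P := by
  obtain ⟨C, hC⟩ := hc'
  exact (hB.memLp_sub a b).mul' (memLp_top_of_bound
    (hc.mono (𝓕.le r) le_rfl).aestronglyMeasurable C (ae_of_all _ hC))

/-- The Itô isometry, polarized, for two processes `c * 1_{(a, b]}` and `c' * 1_{(a', b']}`. -/
theorem integral_mul_sub_mul_mul_sub_of_le (hB : IsBrownianRelativeTo 𝓕 B P) {a b a' b' : ℝ≥0}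
    (hab' : a' ≤ b') (haa' : a ≤ a') {c c' : Ω → ℝ} (hc : Measurable[𝓕 a] c)
    (hcb : ∃ C : ℝ, ∀ ω, |c ω| ≤ C) (hc' : Measurable[𝓕 a'] c')
    (hcb' : ∃ C : ℝ, ∀ ω, |c' ω| ≤ C) :
    ∫ ω, (c ω * (B b ω - B a ω)) * (c' ω * (B b' ω - B a' ω)) ∂P =
      (∫ ω, c ω * c' ω ∂P) * volume.real (Set.Ioc (a : ℝ) b ∩ Set.Ioc (a' : ℝ) b') := by
  have hca' : Measurable[𝓕 a'] c := hc.mono (𝓕.mono haa') le_rfl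
  have hBa' {u : ℝ≥0} (hu : u ≤ a') : Measurable[𝓕 a'] (B u) :=
    (hB.adapted u).mono (𝓕.mono hu) le_rfl
  -- The increment over `(a, b]` is cut at `a'`; the part before `a'` is `𝓕 a'`-measurable.
  have hcut ω : (c ω * (B b ω - B a ω)) * (c' ω * (B b' ω - B a' ω)) =
      (c ω * (B (min b a') ω - B a ω) * c' ω) * (B b' ω - B a' ω) +
        c ω * c' ω * ((B (max b a') ω - B a' ω) * (B b' ω - B a' ω)) := by
    rcases le_total b a' with h | h
    · rw [min_eq_left h, max_eq_right h]; ring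
    · rw [min_eq_right h, max_eq_left h]; ring
  have hint {u v : ℝ≥0} : Integrable
      (fun ω ↦ (c ω * (B v ω - B u ω)) * (c' ω * (B b' ω - B a' ω))) P :=
    (hB.memLp_mul_sub u v hc hcb).integrable_mul (hB.memLp_mul_sub a' b' hc' hcb')
  simp_rw [hcut]
  have hmean := hB.integral_mul_sub_mul_sub (le_max_right b a') hab' (hca'.mul hc')
  simp only [Pi.mul_apply] at hmean
  rw [integral_add, hB.integral_mul_sub_eq_zero hab', zero_add, hmean,
    volume_real_Ioc_inter_Ioc (mod_cast haa') (mod_cast hab')]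
  · simp
  · exact (hca'.mul ((hBa' (min_le_right _ _)).sub (hBa' haa'))).mul hc'
  · exact (hint (u := a) (v := min b a')).congr (ae_of_all _ fun ω ↦ by simp only; ring)
  · exact (hint (u := a') (v := max b a')).congr (ae_of_all _ fun ω ↦ by simp only; ring)

theorem integral_mul_sub_mul_mul_sub (hB : IsBrownianRelativeTo 𝓕 B P) {a b a' b' : ℝ≥0}
    (hab : a ≤ b) (hab' : a' ≤ b') {c c' : Ω → ℝ} (hc : Measurable[𝓕 a] c)
    (hcb : ∃ C : ℝ, ∀ ω, |c ω| ≤ C) (hc' : Measurable[𝓕 a'] c')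
    (hcb' : ∃ C : ℝ, ∀ ω, |c' ω| ≤ C) :
    ∫ ω, (c ω * (B b ω - B a ω)) * (c' ω * (B b' ω - B a' ω)) ∂P =
      (∫ ω, c ω * c' ω ∂P) * volume.real (Set.Ioc (a : ℝ) b ∩ Set.Ioc (a' : ℝ) b') := by
  rcases le_total a a' with h | h
  · exact hB.integral_mul_sub_mul_mul_sub_of_le hab' h hc hcb hc' hcb'
  · have := hB.integral_mul_sub_mul_mul_sub_of_le (b := b') hab h hc' hcb' hc hcb
    rw [Set.inter_comm]
    simpa only [mul_comm] using this

end IsBrownianRelativeTo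

theorem ItoSimpleProcess.memLp_integral {Ω : Type*} {m : MeasurableSpace Ω}
    {𝓕 : Filtration ℝ≥0 m} {B : ℝ≥0 → Ω → ℝ} {P : Measure Ω} {s t : ℝ≥0}
    (φ : ItoSimpleProcess 𝓕 s t) (hB : IsBrownianRelativeTo 𝓕 B P) : MemLp (φ.integral B) 2 P :=
  memLp_finsetSum _ fun k _ ↦ hB.memLp_mul_sub _ _ (φ.coeff_measurable k) (φ.coeff_bounded k)

theorem indicator_Ioc_toNNReal (a b : ℝ≥0) (x u : ℝ) :
    (Set.Ioc a b).indicator (fun _ ↦ x) u.toNNReal =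
      (Set.Ioc (a : ℝ) b).indicator (fun _ ↦ 1) u * x := by
  have : u.toNNReal ∈ Set.Ioc a b ↔ u ∈ Set.Ioc (a : ℝ) b := by
    simp only [Set.mem_Ioc, Real.lt_toNNReal_iff_coe_lt, Real.toNNReal_le_iff_le_coe]
  simp only [Set.indicator_apply, this, ite_mul, one_mul, zero_mul]

section Isometry

variable {Ω : Type*} {m : MeasurableSpace Ω} {𝓕 : Filtration ℝ≥0 m} {B : ℝ≥0 → Ω → ℝ}
  {P : Measure Ω} [IsProbabilityMeasure P] {s t : ℝ≥0}

theorem memLp_indicator_Ioc_toNNReal (a b : ℝ≥0) {r : ℝ≥0} {c : Ω → ℝ} (hc : Measurable[𝓕 r] c)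
    (hcb : ∃ C : ℝ, ∀ ω, |c ω| ≤ C) :
    MemLp (fun p : ℝ × Ω ↦ (Set.Ioc a b).indicator (fun _ ↦ c p.2) p.1.toNNReal) 2
      ((volume.restrict (Set.Ioc (s : ℝ) t)).prod P) := by
  obtain ⟨C, hC⟩ := hcb
  have hcm : Measurable c := hc.mono (𝓕.le r) le_rfl
  have h1 : Measurable ((Set.Ioc (a : ℝ) b).indicator fun _ ↦ (1 : ℝ)) :=
    measurable_const.indicator measurableSet_Ioc
  simp_rw [indicator_Ioc_toNNReal]
  refine MemLp.of_bound (by fun_prop) C (ae_of_all _ fun p ↦ ?_)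
  have hC' : ‖c p.2‖ ≤ C := hC p.2
  by_cases hp : p.1 ∈ Set.Ioc (a : ℝ) b
  · simpa [hp] using hC'
  · simpa [hp] using (norm_nonneg _).trans hC'

/-- The Itô isometry for a finite sum of processes `c k * 1_{(a k, b k]}`; the intervals may
overlap, so that it applies to the difference of two simple processes without passing to a common
refinement of their partitions. -/
theorem IsBrownianRelativeTo.eLpNorm_sum_mul_sub (hB : IsBrownianRelativeTo 𝓕 B P) {ι : Type*}
    (S : Finset ι) {a b : ι → ℝ≥0} {c : ι → Ω → ℝ} (hab : ∀ k, a k ≤ b k)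
    (ha : ∀ k, a k ∈ Set.Icc s t) (hb : ∀ k, b k ∈ Set.Icc s t)
    (hc : ∀ k, Measurable[𝓕 (a k)] (c k)) (hcb : ∀ k, ∃ C : ℝ, ∀ ω, |c k ω| ≤ C) :
    eLpNorm (fun ω ↦ ∑ k ∈ S, c k ω * (B (b k) ω - B (a k) ω)) 2 P =
      eLpNorm (fun p : ℝ × Ω ↦
        ∑ k ∈ S, (Set.Ioc (a k) (b k)).indicator (fun _ ↦ c k p.2) p.1.toNNReal) 2
        ((volume.restrict (Set.Ioc (s : ℝ) t)).prod P) := by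
  have hL (k : ι) := hB.memLp_mul_sub (a k) (b k) (hc k) (hcb k)
  have hR (k : ι) := memLp_indicator_Ioc_toNNReal (P := P) (s := s) (t := t) (a k) (b k)
    (hc k) (hcb k)
  rw [(memLp_finsetSum S fun k _ ↦ hL k).eLpNorm_eq_integral_rpow_norm two_ne_zero
      ENNReal.ofNat_ne_top,
    (memLp_finsetSum S fun k _ ↦ hR k).eLpNorm_eq_integral_rpow_norm two_ne_zero
      ENNReal.ofNat_ne_top]
  simp only [ENNReal.toReal_ofNat, Real.rpow_ofNat, Real.norm_eq_abs, sq_abs]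
  congr 2
  simp_rw [pow_two, Finset.sum_mul_sum]
  have hLL (k l : ι) : Integrable (fun ω ↦ c k ω * (B (b k) ω - B (a k) ω) *
      (c l ω * (B (b l) ω - B (a l) ω))) P := (hL k).integrable_mul (hL l)
  have hRR (k l : ι) : Integrable (fun p : ℝ × Ω ↦
      (Set.Ioc (a k) (b k)).indicator (fun _ ↦ c k p.2) p.1.toNNReal *
        (Set.Ioc (a l) (b l)).indicator (fun _ ↦ c l p.2) p.1.toNNReal)
      ((volume.restrict (Set.Ioc (s : ℝ) t)).prod P) := (hR k).integrable_mul (hR l)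
  rw [integral_finsetSum _ fun k _ ↦ integrable_finsetSum _ fun l _ ↦ hLL k l,
    integral_finsetSum _ fun k _ ↦ integrable_finsetSum _ fun l _ ↦ hRR k l]
  refine Finset.sum_congr rfl fun k _ ↦ ?_
  rw [integral_finsetSum _ fun l _ ↦ hLL k l, integral_finsetSum _ fun l _ ↦ hRR k l]
  refine Finset.sum_congr rfl fun l _ ↦ ?_
  rw [hB.integral_mul_sub_mul_mul_sub (hab k) (hab l) (hc k) (hcb k) (hc l) (hcb l)]
  have hsub : Set.Ioc (a k : ℝ) (b k) ∩ Set.Ioc (a l : ℝ) (b l) ⊆ Set.Ioc (s : ℝ) t := fun x hx ↦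
    ⟨lt_of_le_of_lt (mod_cast (ha k).1) hx.1.1, hx.1.2.trans (mod_cast (hb k).2)⟩
  have hprod (p : ℝ × Ω) :
      (Set.Ioc (a k) (b k)).indicator (fun _ ↦ c k p.2) p.1.toNNReal *
        (Set.Ioc (a l) (b l)).indicator (fun _ ↦ c l p.2) p.1.toNNReal =
      (Set.Ioc (a k : ℝ) (b k) ∩ Set.Ioc (a l : ℝ) (b l)).indicator (fun _ ↦ (1 : ℝ)) p.1 *
        (c k p.2 * c l p.2) := by
    rw [indicator_Ioc_toNNReal, indicator_Ioc_toNNReal]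
    by_cases hk : p.1 ∈ Set.Ioc (a k : ℝ) (b k) <;> by_cases hl : p.1 ∈ Set.Ioc (a l : ℝ) (b l) <;>
      simp [hk, hl]
  simp_rw [hprod]
  rw [integral_prod_mul
      ((Set.Ioc (a k : ℝ) (b k) ∩ Set.Ioc (a l : ℝ) (b l)).indicator fun _ ↦ (1 : ℝ))
      fun ω ↦ c k ω * c l ω,
    integral_indicator (measurableSet_Ioc.inter measurableSet_Ioc), mul_comm]
  congr 1
  rw [Measure.restrict_restrict (measurableSet_Ioc.inter measurableSet_Ioc),
    Set.inter_eq_left.2 hsub]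
  simp

theorem ItoSimpleProcess.memLp_eval (φ : ItoSimpleProcess 𝓕 s t) :
    MemLp (fun p : ℝ × Ω ↦ φ.eval p.1.toNNReal p.2) 2
      ((volume.restrict (Set.Ioc (s : ℝ) t)).prod P) :=
  memLp_finsetSum _ fun k _ ↦ memLp_indicator_Ioc_toNNReal _ _ (φ.coeff_measurable k)
    (φ.coeff_bounded k)

theorem ItoSimpleProcess.eLpNorm_integral_sub_integral (φ ψ : ItoSimpleProcess 𝓕 s t)
    (hB : IsBrownianRelativeTo 𝓕 B P) :
    eLpNorm (fun ω ↦ φ.integral B ω - ψ.integral B ω) 2 P =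
      eLpNorm (fun p : ℝ × Ω ↦ φ.eval p.1.toNNReal p.2 - ψ.eval p.1.toNNReal p.2) 2
        ((volume.restrict (Set.Ioc (s : ℝ) t)).prod P) := by
  have h := hB.eLpNorm_sum_mul_sub (s := s) (t := t)
    ((Finset.range φ.n).disjSum (Finset.range ψ.n))
    (a := Sum.elim φ.time ψ.time) (b := Sum.elim (fun k ↦ φ.time (k + 1)) fun k ↦ ψ.time (k + 1))
    (c := Sum.elim φ.coeff fun k ↦ -ψ.coeff k)
    (by rintro (k | k)
        · exact φ.time_mono k.le_succ
        · exact ψ.time_mono k.le_succ)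
    (by rintro (k | k)
        · exact φ.time_mem k
        · exact ψ.time_mem k)
    (by rintro (k | k)
        · exact φ.time_mem _
        · exact ψ.time_mem _)
    (by rintro (k | k)
        · exact φ.coeff_measurable k
        · exact (ψ.coeff_measurable k).neg)
    (by rintro (k | k)
        · exact φ.coeff_bounded k
        · simpa using ψ.coeff_bounded k)
  simp only [Finset.sum_disjSum, Sum.elim_inl, Sum.elim_inr, Pi.neg_apply, neg_mul,
    Finset.sum_neg_distrib, Set.indicator_neg, ← sub_eq_add_neg] at h
  exact h

/-- `L²` limits of two sequences whose difference tends to zero in `L²` agree almost everywhere. -/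
theorem ae_eq_of_tendsto_eLpNorm_sub {α : Type*} [MeasurableSpace α] {μ : Measure α}
    {X Y : α → ℝ} {f g : ℕ → α → ℝ} (hX : AEStronglyMeasurable X μ)
    (hY : AEStronglyMeasurable Y μ) (hf : ∀ n, AEStronglyMeasurable (f n) μ)
    (hg : ∀ n, AEStronglyMeasurable (g n) μ)
    (hfX : Tendsto (fun n ↦ eLpNorm (fun x ↦ f n x - X x) 2 μ) atTop (𝓝 0))
    (hgY : Tendsto (fun n ↦ eLpNorm (fun x ↦ g n x - Y x) 2 μ) atTop (𝓝 0))
    (hfg : Tendsto (fun n ↦ eLpNorm (fun x ↦ f n x - g n x) 2 μ) atTop (𝓝 0)) : X =ᵐ[μ] Y := by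
  have hbound n : eLpNorm (X - Y) 2 μ ≤ eLpNorm (fun x ↦ f n x - X x) 2 μ +
      eLpNorm (fun x ↦ f n x - g n x) 2 μ + eLpNorm (fun x ↦ g n x - Y x) 2 μ := by
    have h1 : X - Y = ((f n - g n) - (f n - X)) + (g n - Y) := by
      ext x; simp
    rw [h1]
    refine (eLpNorm_add_le (((hf n).sub (hg n)).sub ((hf n).sub hX)) ((hg n).sub hY)
      one_le_two).trans ?_
    rw [add_comm (eLpNorm (fun x ↦ f n x - X x) 2 μ)]
    gcongr
    · exact eLpNorm_sub_le ((hf n).sub (hg n)) ((hf n).sub hX) one_le_two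
    · exact le_rfl
  have h0 : eLpNorm (X - Y) 2 μ ≤ 0 := by
    simpa using ge_of_tendsto' ((hfX.add hfg).add hgY) hbound
  have h1 := (eLpNorm_eq_zero_iff (hX.sub hY) two_ne_zero).1 (le_antisymm h0 bot_le)
  filter_upwards [h1] with x hx
  simpa [sub_eq_zero] using hx

/-- By the Itô isometry, the Itô integral does not depend on the approximating simple
processes. -/
theorem IsItoIntegral.ae_eq (hB : IsBrownianRelativeTo 𝓕 B P) {X : ℝ≥0 → Ω → ℝ} {Y Y' : Ω → ℝ}
    (h : IsItoIntegral P 𝓕 B X s t Y) (h' : IsItoIntegral P 𝓕 B X s t Y') : Y =ᵐ[P] Y' := by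
  obtain ⟨hX, hY, φ, hφX, hφY⟩ := h
  obtain ⟨-, hY', ψ, hψX, hψY⟩ := h'
  refine ae_eq_of_tendsto_eLpNorm_sub hY.1 hY'.1 (fun n ↦ ((φ n).memLp_integral hB).1)
    (fun n ↦ ((ψ n).memLp_integral hB).1) hφY hψY ?_
  simp_rw [ItoSimpleProcess.eLpNorm_integral_sub_integral _ _ hB]
  refine tendsto_of_tendsto_of_tendsto_of_le_of_le tendsto_const_nhds
    (by simpa using hφX.add hψX) (fun _ ↦ bot_le) fun n ↦ ?_
  have := eLpNorm_sub_le (p := 2) ((φ n).memLp_eval.1.sub hX.1) ((ψ n).memLp_eval.1.sub hX.1)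
    one_le_two
  refine le_trans (le_of_eq ?_) this
  congr 1
  ext p
  simp

end Isometry

theorem IsItoIntegral.congr_integrand {Ω : Type*} {m : MeasurableSpace Ω}
    {𝓕 : Filtration ℝ≥0 m} {B : ℝ≥0 → Ω → ℝ} {P : Measure Ω} {s t : ℝ≥0}
    {X X' : ℝ≥0 → Ω → ℝ} {Y : Ω → ℝ}
    (h : IsItoIntegral P 𝓕 B X s t Y) (hXX' : ∀ᵐ ω ∂P, ∀ u, s ≤ u → X u ω = X' u ω) :
    IsItoIntegral P 𝓕 B X' s t Y := by
  have hae : ∀ᵐ p ∂(volume.restrict (Set.Ioc (s : ℝ) t)).prod P,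
      X p.1.toNNReal p.2 = X' p.1.toNNReal p.2 := by
    filter_upwards [Measure.quasiMeasurePreserving_snd.ae hXX',
      Measure.quasiMeasurePreserving_fst.ae (ae_restrict_mem measurableSet_Ioc)] with p hp hp'
    exact hp _ (NNReal.le_toNNReal_of_coe_le hp'.1.le)
  obtain ⟨hX, hY, φ, hφX, hφY⟩ := h
  refine ⟨(memLp_congr_ae hae).1 hX, hY, φ, ?_, hφY⟩
  refine hφX.congr fun n ↦ eLpNorm_congr_ae ?_
  filter_upwards [hae] with p hp
  rw [hp]

/-! ### The Itô integral of a deterministic function -/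

section Paths

variable {f f' : ℝ → ℝ}

/-- Summation by parts for left-endpoint Riemann–Stieltjes sums `∑ f dg` of a `C¹` function `f`
against a continuous function `g`, with the error controlled by the oscillation of `g`. -/
theorem abs_sum_mul_sub_sub_le (hf : ∀ x, HasDerivAt f (f' x) x) (hf' : Continuous f') {g : ℝ → ℝ}
    (hg : Continuous g) {τ : ℕ → ℝ} (hτ : Monotone τ) {N : ℕ} {M ε : ℝ} (hM0 : 0 ≤ M)
    (hM : ∀ x ∈ Set.Icc (τ 0) (τ N), |f' x| ≤ M)
    (hε : ∀ k < N, ∀ x ∈ Set.Ioc (τ k) (τ (k + 1)), |g x - g (τ (k + 1))| ≤ ε) :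
    |∑ k ∈ Finset.range N, f (τ k) * (g (τ (k + 1)) - g (τ k)) -
      (f (τ N) * g (τ N) - f (τ 0) * g (τ 0) - ∫ x in τ 0..τ N, f' x * g x)| ≤
      M * ε * (τ N - τ 0) := by
  have hint (a b : ℝ) : IntervalIntegrable (fun x ↦ f' x * g x) volume a b :=
    (hf'.mul hg).intervalIntegrable a b
  have hterm k : f (τ k) * (g (τ (k + 1)) - g (τ k)) =
      (f (τ (k + 1)) * g (τ (k + 1)) - f (τ k) * g (τ k)) - (∫ x in τ k..τ (k + 1), f' x * g x) +
        ∫ x in τ k..τ (k + 1), f' x * (g x - g (τ (k + 1))) := by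
    have h1 : ∫ x in τ k..τ (k + 1), f' x * (g x - g (τ (k + 1))) =
        (∫ x in τ k..τ (k + 1), f' x * g x) - (f (τ (k + 1)) - f (τ k)) * g (τ (k + 1)) := by
      have hint' : IntervalIntegrable (fun x ↦ f' x * g (τ (k + 1))) volume (τ k) (τ (k + 1)) :=
        (hf'.mul continuous_const).intervalIntegrable _ _
      simp_rw [mul_sub]
      rw [intervalIntegral.integral_sub (hint _ _) hint',
        intervalIntegral.integral_mul_const,
        intervalIntegral.integral_eq_sub_of_hasDerivAt (fun x _ ↦ hf x)
          (hf'.intervalIntegrable _ _)]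
    rw [h1]
    ring
  have hsum : ∑ k ∈ Finset.range N, f (τ k) * (g (τ (k + 1)) - g (τ k)) -
      (f (τ N) * g (τ N) - f (τ 0) * g (τ 0) - ∫ x in τ 0..τ N, f' x * g x) =
      ∑ k ∈ Finset.range N, ∫ x in τ k..τ (k + 1), f' x * (g x - g (τ (k + 1))) := by
    simp_rw [hterm]
    rw [Finset.sum_add_distrib, Finset.sum_sub_distrib,
      Finset.sum_range_sub (fun k ↦ f (τ k) * g (τ k)),
      intervalIntegral.sum_integral_adjacent_intervals fun k _ ↦ hint _ _]
    ring
  rw [hsum, ← Finset.sum_range_sub τ, Finset.mul_sum]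
  refine (Finset.abs_sum_le_sum_abs _ _).trans (Finset.sum_le_sum fun k hk ↦ ?_)
  have hk := Finset.mem_range.1 hk
  have hle := hτ k.le_succ
  have hbound : ∀ x ∈ Set.uIoc (τ k) (τ (k + 1)), ‖f' x * (g x - g (τ (k + 1)))‖ ≤ M * ε := by
    intro x hx
    rw [Set.uIoc_of_le hle] at hx
    rw [norm_mul]
    exact mul_le_mul (hM x ⟨(hτ k.zero_le).trans hx.1.le, hx.2.trans (hτ hk)⟩) (hε k hk x hx)
      (norm_nonneg _) hM0
  have := intervalIntegral.norm_integral_le_of_norm_le_const hbound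
  rwa [abs_of_nonneg (sub_nonneg.2 hle)] at this

end Paths

/-- The `k`-th point of the partition of `[s, t]` into `n + 1` intervals of equal length, constant
equal to `t` for `k ≥ n + 1`. -/
noncomputable def uniformTime (s t : ℝ≥0) (n k : ℕ) : ℝ≥0 :=
  s + (t - s) * ((min k (n + 1) : ℕ) / (n + 1 : ℕ))

section UniformTime

variable {s t : ℝ≥0} (n : ℕ)

theorem uniformTime_mono : Monotone (uniformTime s t n) := fun k l hkl ↦ by
  unfold uniformTime
  gcongr

theorem uniformTime_zero : uniformTime s t n 0 = s := by
  simp [uniformTime]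

theorem uniformTime_last (hst : s ≤ t) : uniformTime s t n (n + 1) = t := by
  rw [uniformTime, min_self, div_self (by positivity), mul_one, add_tsub_cancel_of_le hst]

theorem uniformTime_mem_Icc (hst : s ≤ t) (k : ℕ) : uniformTime s t n k ∈ Set.Icc s t := by
  refine ⟨le_self_add, ?_⟩
  calc uniformTime s t n k ≤ s + (t - s) * 1 := by
        unfold uniformTime
        gcongr
        exact div_le_one_of_le₀ (mod_cast min_le_right _ _) (by positivity)
    _ = t := by rw [mul_one, add_tsub_cancel_of_le hst]

theorem coe_uniformTime_succ_sub (hst : s ≤ t) {k : ℕ} (hk : k < n + 1) :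
    (uniformTime s t n (k + 1) : ℝ) - uniformTime s t n k = ((t : ℝ) - s) / (n + 1 : ℕ) := by
  rw [uniformTime, uniformTime, min_eq_left hk, min_eq_left hk.le]
  push_cast [NNReal.coe_sub hst]
  ring

theorem exists_mem_Ioc_uniformTime (hst : s ≤ t) {u : ℝ≥0} (hu : u ∈ Set.Ioc s t) :
    ∃ k < n + 1, u ∈ Set.Ioc (uniformTime s t n k) (uniformTime s t n (k + 1)) := by
  have h : ∃ k, u ≤ uniformTime s t n k := ⟨n + 1, by rw [uniformTime_last n hst]; exact hu.2⟩
  classical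
  have h0 : Nat.find h ≠ 0 := fun h0 ↦ by
    have := Nat.find_spec h
    rw [h0, uniformTime_zero] at this
    exact absurd hu.1 (not_lt.2 this)
  obtain ⟨k, hk⟩ := Nat.exists_eq_succ_of_ne_zero h0
  refine ⟨k, ?_, not_le.1 (Nat.find_min h (by omega)), ?_⟩
  · have := Nat.find_min' h (m := n + 1) (by rw [uniformTime_last n hst]; exact hu.2)
    omega
  · rw [← Nat.succ_eq_add_one, ← hk]
    exact Nat.find_spec h

end UniformTime

/-- The left-endpoint step function of `f` along the uniform partition of `[s, t]` into `n + 1`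
intervals. -/
noncomputable def uniformStep {Ω : Type*} {m : MeasurableSpace Ω} (𝓕 : Filtration ℝ≥0 m)
    {s t : ℝ≥0} (hst : s ≤ t) (f : ℝ → ℝ) (n : ℕ) : ItoSimpleProcess 𝓕 s t where
  n := n + 1
  time := uniformTime s t n
  time_mono := uniformTime_mono n
  time_mem := uniformTime_mem_Icc n hst
  coeff k _ := f (uniformTime s t n k)
  coeff_measurable _ := measurable_const
  coeff_bounded k := ⟨|f (uniformTime s t n k)|, fun _ ↦ le_rfl⟩

/-- The integration by parts formula `f(t) B_t - f(s) B_s - ∫_s^t f'(u) B_u du` for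
`∫_s^t f(u) dB_u`. -/
noncomputable def wienerIntegral {Ω : Type*} (f f' : ℝ → ℝ) (B : ℝ≥0 → Ω → ℝ)
    (s t : ℝ≥0) (ω : Ω) : ℝ :=
  f t * B t ω - f s * B s ω - ∫ u in (s : ℝ)..t, f' u * B u.toNNReal ω

/-- Eventually the mesh of the uniform partition of `[s, t]` is finer than the modulus of continuity
of `g` for `ε`. -/
theorem exists_uniform_modulus {g : ℝ → ℝ} (hg : Continuous g) (s t : ℝ≥0) {ε : ℝ} (hε : 0 < ε) :
    ∀ᶠ n : ℕ in atTop, ∀ x ∈ Set.Icc (s : ℝ) t, ∀ y ∈ Set.Icc (s : ℝ) t,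
      |x - y| ≤ ((t : ℝ) - s) / (n + 1 : ℕ) → |g x - g y| ≤ ε := by
  obtain ⟨δ, hδ, h⟩ := Metric.uniformContinuousOn_iff.1
    ((isCompact_Icc (a := (s : ℝ)) (b := t)).uniformContinuousOn_of_continuous hg.continuousOn) ε hε
  have hlim : Tendsto (fun n : ℕ ↦ ((t : ℝ) - s) / (n + 1 : ℕ)) atTop (𝓝 0) :=
    (tendsto_const_div_atTop_nhds_zero_nat ((t : ℝ) - s)).comp (tendsto_add_atTop_nat 1)
  filter_upwards [hlim.eventually_lt_const hδ] with n hn x hx y hy hxy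
  exact (h x hx y hy (hxy.trans_lt hn)).le

section Wiener

variable {Ω : Type*} {m : MeasurableSpace Ω} {𝓕 : Filtration ℝ≥0 m} {B : ℝ≥0 → Ω → ℝ}
  {P : Measure Ω} {s t : ℝ≥0} {f f' : ℝ → ℝ}

theorem tendsto_integral_uniformStep (hst : s ≤ t) (hf : ∀ x, HasDerivAt f (f' x) x)
    (hf' : Continuous f') {ω : Ω} (hBω : Continuous fun u ↦ B u ω) :
    Tendsto (fun n ↦ (uniformStep 𝓕 hst f n).integral B ω) atTop
      (𝓝 (wienerIntegral f f' B s t ω)) := by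
  obtain ⟨M, hM⟩ := (isCompact_Icc (a := (s : ℝ)) (b := t)).exists_bound_of_continuousOn
    hf'.continuousOn
  have hM0 : 0 ≤ M := (norm_nonneg _).trans (hM s ⟨le_rfl, mod_cast hst⟩)
  have hg : Continuous fun u : ℝ ↦ B u.toNNReal ω := hBω.comp continuous_real_toNNReal
  rw [Metric.tendsto_atTop']
  intro ε hε
  -- Adding `1` to the denominator covers the cases `M = 0` and `s = t`.
  set η : ℝ := ε / (M * ((t : ℝ) - s) + 1) with hη
  have hst' : 0 ≤ (t : ℝ) - s := sub_nonneg.2 (mod_cast hst)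
  have hη0 : 0 < η := by positivity
  obtain ⟨N, hN⟩ := eventually_atTop.1 (exists_uniform_modulus hg s t hη0)
  refine ⟨N, fun n hn ↦ ?_⟩
  have hmem k : (uniformTime s t n k : ℝ) ∈ Set.Icc (s : ℝ) t :=
    ⟨mod_cast (uniformTime_mem_Icc n hst k).1, mod_cast (uniformTime_mem_Icc n hst k).2⟩
  have h := abs_sum_mul_sub_sub_le hf hf' hg (τ := fun k ↦ (uniformTime s t n k : ℝ)) (N := n + 1)
    (fun k l hkl ↦ NNReal.coe_le_coe.2 (uniformTime_mono n hkl)) (ε := η) hM0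
    (by simpa only [uniformTime_zero, uniformTime_last n hst, Real.norm_eq_abs] using hM)
    (fun k hk x hx ↦ by
      refine hN n hn.le x ⟨(hmem k).1.trans hx.1.le, hx.2.trans (hmem _).2⟩ _ (hmem _) ?_
      rw [← coe_uniformTime_succ_sub n hst hk, abs_sub_comm, abs_of_nonneg (sub_nonneg.2 hx.2)]
      exact sub_le_sub_left hx.1.le _)
  simp only [uniformTime_zero, uniformTime_last n hst, Real.toNNReal_coe] at h
  rw [Real.dist_eq]
  refine lt_of_le_of_lt h ?_
  rw [hη, mul_div_assoc', div_mul_eq_mul_div, div_lt_iff₀ (by positivity)]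
  nlinarith

theorem eval_uniformStep (hst : s ≤ t) {n k : ℕ} (hk : k < n + 1) {u : ℝ≥0}
    (hu : u ∈ Set.Ioc (uniformTime s t n k) (uniformTime s t n (k + 1))) (ω : Ω) :
    (uniformStep 𝓕 hst f n).eval u ω = f (uniformTime s t n k) := by
  refine (Finset.sum_eq_single_of_mem k (Finset.mem_range.2 hk) fun l _ hlk ↦ ?_).trans ?_
  · refine Set.indicator_of_notMem (fun hul ↦ ?_) _
    exact Set.disjoint_left.1
      ((uniformTime_mono (s := s) (t := t) n).pairwise_disjoint_on_Ioc_succ hlk) hul hu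
  · exact Set.indicator_of_mem hu _

variable [IsProbabilityMeasure P]

theorem tendsto_eLpNorm_eval_uniformStep_sub (hst : s ≤ t) (hf : Continuous f) :
    Tendsto (fun n ↦ eLpNorm (fun p : ℝ × Ω ↦
      (uniformStep 𝓕 hst f n).eval p.1.toNNReal p.2 - f p.1.toNNReal) 2
      ((volume.restrict (Set.Ioc (s : ℝ) t)).prod P)) atTop (𝓝 0) := by
  set μ := (volume.restrict (Set.Ioc (s : ℝ) t)).prod P
  have hμ : μ Set.univ ^ (2 : ℝ≥0∞).toReal⁻¹ ≠ ∞ :=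
    ENNReal.rpow_ne_top_of_nonneg (by positivity) (measure_ne_top μ _)
  have key {η : ℝ} (hη : 0 < η) : ∀ᶠ n : ℕ in atTop, eLpNorm (fun p : ℝ × Ω ↦
      (uniformStep 𝓕 hst f n).eval p.1.toNNReal p.2 - f p.1.toNNReal) 2 μ ≤
        μ Set.univ ^ (2 : ℝ≥0∞).toReal⁻¹ * ENNReal.ofReal η := by
    filter_upwards [exists_uniform_modulus hf s t hη] with n hn
    refine eLpNorm_le_of_ae_bound ?_
    filter_upwards [Measure.quasiMeasurePreserving_fst.ae (ae_restrict_mem measurableSet_Ioc)]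
      with p hp
    have hp' : p.1.toNNReal ∈ Set.Ioc s t :=
      ⟨Real.lt_toNNReal_iff_coe_lt.2 hp.1, Real.toNNReal_le_iff_le_coe.2 hp.2⟩
    obtain ⟨k, hk, hpk⟩ := exists_mem_Ioc_uniformTime n hst hp'
    have hmem := uniformTime_mem_Icc n hst k
    rw [eval_uniformStep hst hk hpk]
    refine hn _ ⟨mod_cast hmem.1, mod_cast hmem.2⟩ _ ⟨mod_cast hp'.1.le, mod_cast hp'.2⟩ ?_
    rw [← coe_uniformTime_succ_sub n hst hk, abs_sub_comm,
      abs_of_nonneg (sub_nonneg.2 (mod_cast hpk.1.le))]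
    exact sub_le_sub_right (mod_cast hpk.2) _
  have hlim : Tendsto (fun η : ℝ ↦ μ Set.univ ^ (2 : ℝ≥0∞).toReal⁻¹ * ENNReal.ofReal η)
      (𝓝[>] 0) (𝓝 0) := by
    have h0 : Tendsto (fun η : ℝ ↦ ENNReal.ofReal η) (𝓝 0) (𝓝 0) := by
      simpa using ENNReal.continuous_ofReal.tendsto 0
    simpa using ENNReal.Tendsto.const_mul (h0.mono_left nhdsWithin_le_nhds) (Or.inr hμ)
  rw [ENNReal.tendsto_nhds_zero]
  intro ε hε
  obtain ⟨η, hη, hη0⟩ := ((hlim.eventually_le_const hε).and self_mem_nhdsWithin).exists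
  filter_upwards [key hη0] with n hn using hn.trans hη

/-- The Itô integral of a `C¹` function is given by integration by parts. The integrals of the
step functions converge almost surely to the right-hand side; they are Cauchy in `L²` by the Itô
isometry, so by Fatou's lemma they converge in `L²` too. -/
theorem IsBrownianRelativeTo.isItoIntegral_wienerIntegral (hB : IsBrownianRelativeTo 𝓕 B P)
    (hst : s ≤ t) (hf : ∀ x, HasDerivAt f (f' x) x) (hf' : Continuous f') :
    IsItoIntegral P 𝓕 B (fun u _ ↦ f u) s t (wienerIntegral f f' B s t) := by
  have hfc : Continuous f := continuous_iff_continuousAt.2 fun x ↦ (hf x).continuousAt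
  set μ := (volume.restrict (Set.Ioc (s : ℝ) t)).prod P
  set φ := uniformStep 𝓕 hst f
  have hfL : MemLp (fun p : ℝ × Ω ↦ f p.1.toNNReal) 2 μ := by
    obtain ⟨C, hC⟩ := (isCompact_Icc (a := (s : ℝ)) (b := t)).exists_bound_of_continuousOn
      hfc.continuousOn
    refine MemLp.of_bound (by fun_prop) C ?_
    filter_upwards [Measure.quasiMeasurePreserving_fst.ae (ae_restrict_mem measurableSet_Ioc)]
      with p hp
    rw [Real.coe_toNNReal _ (s.2.trans hp.1.le)]
    exact hC _ ⟨hp.1.le, hp.2⟩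
  have hφf := tendsto_eLpNorm_eval_uniformStep_sub (𝓕 := 𝓕) (P := P) hst hfc
  have hlim : ∀ᵐ ω ∂P, Tendsto (fun n ↦ (φ n).integral B ω) atTop
      (𝓝 (wienerIntegral f f' B s t ω)) :=
    hB.isBrownianReal.cont.mono fun ω hω ↦ tendsto_integral_uniformStep hst hf hf' hω
  have hI n : MemLp ((φ n).integral B) 2 P := (φ n).memLp_integral hB
  have hYm : AEStronglyMeasurable (wienerIntegral f f' B s t) P :=
    aestronglyMeasurable_of_tendsto_ae atTop (fun n ↦ (hI n).1) hlim
  have hbound n : eLpNorm (fun ω ↦ (φ n).integral B ω - wienerIntegral f f' B s t ω) 2 P ≤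
      eLpNorm (fun p : ℝ × Ω ↦ (φ n).eval p.1.toNNReal p.2 - f p.1.toNNReal) 2 μ := by
    refine (Lp.eLpNorm_lim_le_liminf_eLpNorm (p := 2)
      (f := fun k ω ↦ (φ n).integral B ω - (φ k).integral B ω) (fun k ↦ (hI n).1.sub (hI k).1) _
      (hlim.mono fun ω hω ↦ tendsto_const_nhds.sub hω)).trans ?_
    have hle k : eLpNorm (fun ω ↦ (φ n).integral B ω - (φ k).integral B ω) 2 P ≤
        eLpNorm (fun p : ℝ × Ω ↦ (φ n).eval p.1.toNNReal p.2 - f p.1.toNNReal) 2 μ +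
          eLpNorm (fun p : ℝ × Ω ↦ (φ k).eval p.1.toNNReal p.2 - f p.1.toNNReal) 2 μ := by
      rw [ItoSimpleProcess.eLpNorm_integral_sub_integral _ _ hB]
      refine le_trans (le_of_eq ?_) (eLpNorm_sub_le (p := 2) ((φ n).memLp_eval.1.sub hfL.1)
        ((φ k).memLp_eval.1.sub hfL.1) one_le_two)
      congr 1
      ext p
      simp
    refine (liminf_le_liminf (Eventually.of_forall hle)).trans ?_
    rw [(tendsto_const_nhds.add hφf).liminf_eq, add_zero]
  have hIY := tendsto_of_tendsto_of_tendsto_of_le_of_le tendsto_const_nhds hφf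
    (fun _ ↦ bot_le) hbound
  refine ⟨hfL, ?_, φ, hφf, hIY⟩
  have h0 : MemLp (fun ω ↦ (φ 0).integral B ω - wienerIntegral f f' B s t ω) 2 P :=
    ⟨(hI 0).1.sub hYm, (hbound 0).trans_lt ((φ 0).memLp_eval.sub hfL).2⟩
  refine ((hI 0).sub h0).ae_eq (ae_of_all _ fun ω ↦ ?_)
  simp

theorem continuous_wienerIntegral (hf : Continuous f) (hf' : Continuous f') {ω : Ω}
    (hBω : Continuous fun u ↦ B u ω) : Continuous fun t ↦ wienerIntegral f f' B s t ω := by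
  have hg : Continuous fun u : ℝ ↦ f' u * B u.toNNReal ω :=
    hf'.mul (hBω.comp continuous_real_toNNReal)
  have h := (intervalIntegral.continuous_primitive (μ := volume)
    (fun a b ↦ hg.intervalIntegrable a b) (s : ℝ)).comp NNReal.continuous_coe
  exact (((hf.comp NNReal.continuous_coe).mul hBω).sub continuous_const).sub h

theorem IsBrownianRelativeTo.isItoIntegralProcess_wienerIntegral
    (hB : IsBrownianRelativeTo 𝓕 B P) (hf : ∀ x, HasDerivAt f (f' x) x) (hf' : Continuous f')
    (s : ℝ≥0) :
    IsItoIntegralProcess P 𝓕 B (fun u _ ↦ f u) s (wienerIntegral f f' B s) :=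
  ⟨hB.isBrownianReal.cont.mono fun _ hω ↦ (continuous_wienerIntegral
    (continuous_iff_continuousAt.2 fun x ↦ (hf x).continuousAt) hf' hω).continuousOn,
    fun _ hst ↦ hB.isItoIntegral_wienerIntegral hst hf hf'⟩

/-- Every continuous version of the Itô integral of a `C¹` function is indistinguishable from the
integration by parts formula. -/
theorem IsItoIntegralProcess.ae_forall_eq_wienerIntegral (hB : IsBrownianRelativeTo 𝓕 B P)
    (hf : ∀ x, HasDerivAt f (f' x) x) (hf' : Continuous f') {X J : ℝ≥0 → Ω → ℝ}
    (hJ : IsItoIntegralProcess P 𝓕 B X s J) (hX : ∀ᵐ ω ∂P, ∀ u, s ≤ u → X u ω = f u) :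
    ∀ᵐ ω ∂P, ∀ t, s ≤ t → J t ω = wienerIntegral f f' B s t ω := by
  have hfc : Continuous f := continuous_iff_continuousAt.2 fun x ↦ (hf x).continuousAt
  have hdense : ∀ᵐ ω ∂P, ∀ n, J (s + TopologicalSpace.denseSeq ℝ≥0 n) ω =
      wienerIntegral f f' B s (s + TopologicalSpace.denseSeq ℝ≥0 n) ω :=
    ae_all_iff.2 fun n ↦ ((hJ.2 _ le_self_add).congr_integrand hX).ae_eq hB
      (hB.isItoIntegral_wienerIntegral le_self_add hf hf')
  filter_upwards [hdense, hJ.1, hB.isBrownianReal.cont] with ω hω hJω hBω t hst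
  have h1 : Continuous fun u ↦ J (s + u) ω :=
    hJω.comp_continuous (by fun_prop) fun u ↦ Set.mem_Ici.2 le_self_add
  have h2 : Continuous fun u ↦ wienerIntegral f f' B s (s + u) ω :=
    (continuous_wienerIntegral hfc hf' hBω).comp (by fun_prop)
  have h := congrFun ((TopologicalSpace.denseRange_denseSeq ℝ≥0).equalizer h1 h2 (funext hω))
    (t - s)
  simpa only [add_tsub_cancel_of_le hst] using h

end Wiener

/-! ### Iterated integrals of space-time Brownian motion -/

/-- The iterated integral along the word `w` (head of the list outermost) exists, and all its
versions are indistinguishable on `[s, ∞)` from the process `g`. -/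
def HasIteratedIntegralRev {Ω : Type*} {m : MeasurableSpace Ω} {d : ℕ} (P : Measure Ω)
    (𝓕 : Filtration ℝ≥0 m) (W : ℝ≥0 → Ω → EuclideanSpace ℝ (Fin d)) (s : ℝ≥0)
    (w : List (SpaceTimeLetter d)) (g : ℝ≥0 → Ω → ℝ) : Prop :=
  (∃ J, IsIteratedIntegralRev P 𝓕 W s w J) ∧
  ∀ J, IsIteratedIntegralRev P 𝓕 W s w J → ∀ᵐ ω ∂P, ∀ t, s ≤ t → J t ω = g t ω

namespace HasIteratedIntegralRev

variable {Ω : Type*} {m : MeasurableSpace Ω} {d : ℕ} {P : Measure Ω} {𝓕 : Filtration ℝ≥0 m}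
  {W : ℝ≥0 → Ω → EuclideanSpace ℝ (Fin d)} {s : ℝ≥0} {w : List (SpaceTimeLetter d)}
  {g g' : ℝ≥0 → Ω → ℝ}

theorem nil : HasIteratedIntegralRev P 𝓕 W s [] fun _ _ ↦ 1 :=
  ⟨⟨fun _ _ ↦ 1, fun _ _ ↦ rfl⟩, fun _ hJ ↦ ae_of_all _ fun ω t _ ↦ hJ t ω⟩

theorem congr (h : HasIteratedIntegralRev P 𝓕 W s w g)
    (hgg' : ∀ᵐ ω ∂P, ∀ t, s ≤ t → g t ω = g' t ω) : HasIteratedIntegralRev P 𝓕 W s w g' := by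
  refine ⟨h.1, fun J hJ ↦ ?_⟩
  filter_upwards [h.2 J hJ, hgg'] with ω h1 h2 t ht
  rw [h1 t ht, h2 t ht]

/-- Appending an outermost time integral. Continuity of `g` supplies the integrability that is part
of the definition of a time integral. -/
theorem cons_time (h : HasIteratedIntegralRev P 𝓕 W s w g)
    (hg : ∀ᵐ ω ∂P, Continuous fun u ↦ g u ω) :
    HasIteratedIntegralRev P 𝓕 W s (.time :: w)
      fun t ω ↦ ∫ u in (s : ℝ)..t, g u.toNNReal ω := by
  have heq {X : ℝ≥0 → Ω → ℝ} {ω : Ω} (hX : ∀ u, s ≤ u → X u ω = g u ω) {t : ℝ≥0} (hst : s ≤ t) :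
      Set.EqOn (fun u : ℝ ↦ X u.toNNReal ω) (fun u : ℝ ↦ g u.toNNReal ω)
        (Set.uIcc (s : ℝ) t) := fun u hu ↦ by
    rw [Set.uIcc_of_le (mod_cast hst)] at hu
    exact hX _ (NNReal.le_toNNReal_of_coe_le hu.1)
  obtain ⟨⟨X, hX⟩, hg'⟩ := h
  refine ⟨⟨fun t ω ↦ ∫ u in (s : ℝ)..t, X u.toNNReal ω, X, hX, ?_⟩, ?_⟩
  · filter_upwards [hg' X hX, hg] with ω hω hgω t hst
    refine ⟨?_, rfl⟩
    exact ((hgω.comp continuous_real_toNNReal).intervalIntegrable (s : ℝ) t).congr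
      fun u hu ↦ (heq hω hst (Set.uIoc_subset_uIcc hu)).symm
  · rintro J ⟨X, hX, hJ⟩
    filter_upwards [hg' X hX, hJ] with ω hω hJω t hst
    rw [(hJω t hst).2]
    exact intervalIntegral.integral_congr (heq hω hst)

/-- Appending an outermost Itô integral to a process that is a deterministic `C¹` function of
time. -/
theorem cons_space [IsProbabilityMeasure P] {i : Fin d} {f f' : ℝ → ℝ}
    (hB : IsBrownianRelativeTo 𝓕 (fun t ω ↦ W t ω i) P)
    (h : HasIteratedIntegralRev P 𝓕 W s w fun u _ ↦ f u) (hf : ∀ x, HasDerivAt f (f' x) x)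
    (hf' : Continuous f') :
    HasIteratedIntegralRev P 𝓕 W s (.space i :: w)
      (wienerIntegral f f' (fun t ω ↦ W t ω i) s) := by
  obtain ⟨⟨X, hX⟩, hg⟩ := h
  refine ⟨⟨wienerIntegral f f' (fun t ω ↦ W t ω i) s, X, hX, ?_⟩, ?_⟩
  · obtain ⟨h1, h2⟩ := hB.isItoIntegralProcess_wienerIntegral hf hf' s
    exact ⟨h1, fun t hst ↦ (h2 t hst).congr_integrand <|
      (hg X hX).mono fun ω hω u hu ↦ (hω u hu).symm⟩
  · rintro J ⟨X, hX, hJ⟩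
    exact hJ.ae_forall_eq_wienerIntegral hB hf hf' (hg X hX)

theorem iteratedIntegralEq {t : ℝ≥0} {Y : Ω → ℝ}
    (h : HasIteratedIntegralRev P 𝓕 W s w.reverse g) (hst : s ≤ t)
    (hY : ∀ᵐ ω ∂P, g t ω = Y ω) : IteratedIntegralEq P 𝓕 W s t w Y := by
  refine ⟨h.1, fun J hJ ↦ ?_⟩
  filter_upwards [h.2 J hJ, hY] with ω h1 h2
  rw [h1 t hst, h2]

end HasIteratedIntegralRev

/-! ### Pathwise computations -/

section Moments

variable {Ω : Type*} {d : ℕ} {W : ℝ≥0 → Ω → EuclideanSpace ℝ (Fin d)} {ω : Ω}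

theorem continuous_path_toNNReal (hω : Continuous fun u ↦ W u ω) (i : Fin d) :
    Continuous fun u : ℝ ↦ W u.toNNReal ω i := by
  have := hω.comp continuous_real_toNNReal
  fun_prop

theorem integral_sub_left_endpoint (s t : ℝ) : ∫ u in s..t, (u - s) = (t - s) ^ 2 / 2 := by
  rw [intervalIntegral.integral_comp_sub_right (fun x ↦ x), integral_id]
  ring

theorem integral_sub_left_endpoint_sq (s t : ℝ) : ∫ u in s..t, (u - s) ^ 2 = (t - s) ^ 3 / 3 := by
  rw [intervalIntegral.integral_comp_sub_right (fun x ↦ x ^ 2), integral_pow]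
  norm_num

theorem continuous_brownianBridge (hω : Continuous fun u ↦ W u ω) (s t : ℝ≥0) :
    Continuous fun u : ℝ ↦ brownianBridge W s t u ω := by
  have h := hω.comp continuous_real_toNNReal
  have h' : Continuous fun u : ℝ ↦ W u.toNNReal ω := h
  unfold brownianBridge pathIncrement
  fun_prop

/-- The space-time Lévy area in terms of the integral of the path. -/
theorem mul_spaceTimeLevyArea_apply (hω : Continuous fun u ↦ W u ω) (s t : ℝ≥0) (i : Fin d) :
    ((t : ℝ) - s) * spaceTimeLevyArea W s t ω i =
      (∫ u in (s : ℝ)..t, W u.toNNReal ω i) - ((t : ℝ) - s) * W s ω i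
        - 1 / 2 * ((t : ℝ) - s) * (W t ω i - W s ω i) := by
  rcases eq_or_ne ((t : ℝ) - s) 0 with h0 | h0
  -- For `s = t` both sides vanish, since division by zero gives zero.
  · rw [sub_eq_zero] at h0
    simp [h0]
  have hW := continuous_path_toNNReal hω i
  have hcoord : (∫ u in (s : ℝ)..t, brownianBridge W s t u ω) i =
      ∫ u in (s : ℝ)..t, brownianBridge W s t u ω i :=
    ((EuclideanSpace.proj (𝕜 := ℝ) i).intervalIntegral_comp_comm
      ((continuous_brownianBridge hω s t).intervalIntegrable _ _)).symm
  have hint : ∫ u in (s : ℝ)..t, brownianBridge W s t u ω i =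
      (∫ u in (s : ℝ)..t, W u.toNNReal ω i) - ((t : ℝ) - s) * W s ω i
        - (∫ u in (s : ℝ)..t, (u - s)) * ((W t ω i - W s ω i) / ((t : ℝ) - s)) := by
    have c₁ : Continuous fun u : ℝ ↦ W u.toNNReal ω i - W s ω i := by fun_prop
    have c₂ : Continuous fun u : ℝ ↦ (u - s) * ((W t ω i - W s ω i) / ((t : ℝ) - s)) := by
      fun_prop
    rw [← intervalIntegral.integral_mul_const, ← smul_eq_mul ((t : ℝ) - s),
      ← intervalIntegral.integral_const, ← intervalIntegral.integral_sub
        (hW.intervalIntegrable _ _) (continuous_const.intervalIntegrable _ _),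
      ← intervalIntegral.integral_sub (c₁.intervalIntegrable _ _) (c₂.intervalIntegrable _ _)]
    refine intervalIntegral.integral_congr fun u _ ↦ ?_
    simp only [brownianBridge, pathIncrement, PiLp.sub_apply, PiLp.smul_apply, smul_eq_mul]
    ring
  rw [spaceTimeLevyArea, PiLp.smul_apply, smul_eq_mul, hcoord, hint, integral_sub_left_endpoint]
  field_simp

/-- The space-time-time Lévy area in terms of the first two moments of the path. -/
theorem sq_mul_spaceTimeTimeLevyArea_apply (hω : Continuous fun u ↦ W u ω) (s t : ℝ≥0)
    (i : Fin d) :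
    ((t : ℝ) - s) ^ 2 * spaceTimeTimeLevyArea W s t ω i =
      1 / 2 * ((t : ℝ) - s) * (∫ u in (s : ℝ)..t, W u.toNNReal ω i)
        - (∫ u in (s : ℝ)..t, (u - s) * W u.toNNReal ω i)
        + 1 / 12 * ((t : ℝ) - s) ^ 2 * (W t ω i - W s ω i) := by
  rcases eq_or_ne ((t : ℝ) - s) 0 with h0 | h0
  -- For `s = t` both sides vanish, since division by zero gives zero.
  · rw [sub_eq_zero] at h0
    simp [h0]
  have hW := continuous_path_toNNReal hω i
  set h : ℝ := (t : ℝ) - s with hh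
  have hK : Continuous fun u : ℝ ↦ (1 / 2 * h - (u - s)) • brownianBridge W s t u ω :=
    (by fun_prop : Continuous fun u : ℝ ↦ 1 / 2 * h - (u - s)).smul
      (continuous_brownianBridge hω s t)
  have hcoord : (∫ u in (s : ℝ)..t, (1 / 2 * h - (u - s)) • brownianBridge W s t u ω) i =
      ∫ u in (s : ℝ)..t, ((1 / 2 * h - (u - s)) • brownianBridge W s t u ω) i :=
    ((EuclideanSpace.proj (𝕜 := ℝ) i).intervalIntegral_comp_comm
      (hK.intervalIntegrable _ _)).symm
  set D : ℝ := W t ω i - W s ω i with hD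
  have hexp (u : ℝ) : ((1 / 2 * h - (u - s)) • brownianBridge W s t u ω) i =
      1 / 2 * h * W u.toNNReal ω i - (u - s) * W u.toNNReal ω i - 1 / 2 * h * W s ω i
        + (u - s) * (W s ω i - 1 / 2 * D) + (u - s) ^ 2 * (D / h) := by
    simp only [brownianBridge, pathIncrement, PiLp.sub_apply, PiLp.smul_apply, smul_eq_mul, ← hh,
      ← hD]
    field_simp
    ring
  have hint : ∫ u in (s : ℝ)..t, ((1 / 2 * h - (u - s)) • brownianBridge W s t u ω) i =
      1 / 2 * h * (∫ u in (s : ℝ)..t, W u.toNNReal ω i)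
        - (∫ u in (s : ℝ)..t, (u - s) * W u.toNNReal ω i) - h * (1 / 2 * h * W s ω i)
        + h ^ 2 / 2 * (W s ω i - 1 / 2 * D) + h ^ 3 / 3 * (D / h) := by
    simp_rw [hexp]
    have c₁ : Continuous fun u : ℝ ↦ 1 / 2 * h * W u.toNNReal ω i := by fun_prop
    have c₂ : Continuous fun u : ℝ ↦ (u - s) * W u.toNNReal ω i := by fun_prop
    have c₃ : Continuous fun _ : ℝ ↦ 1 / 2 * h * W s ω i := continuous_const
    have c₄ : Continuous fun u : ℝ ↦ (u - s) * (W s ω i - 1 / 2 * D) := by fun_prop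
    have c₅ : Continuous fun u : ℝ ↦ (u - s) ^ 2 * (D / h) := by fun_prop
    have c₁₂ := c₁.fun_sub c₂
    have c₁₂₃ := c₁₂.fun_sub c₃
    have c₁₂₃₄ := c₁₂₃.fun_add c₄
    rw [intervalIntegral.integral_add (c₁₂₃₄.intervalIntegrable _ _) (c₅.intervalIntegrable _ _),
      intervalIntegral.integral_add (c₁₂₃.intervalIntegrable _ _) (c₄.intervalIntegrable _ _),
      intervalIntegral.integral_sub (c₁₂.intervalIntegrable _ _) (c₃.intervalIntegrable _ _),
      intervalIntegral.integral_sub (c₁.intervalIntegrable _ _) (c₂.intervalIntegrable _ _),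
      intervalIntegral.integral_const_mul, intervalIntegral.integral_const, smul_eq_mul,
      intervalIntegral.integral_mul_const, intervalIntegral.integral_mul_const,
      integral_sub_left_endpoint, integral_sub_left_endpoint_sq]
  rw [spaceTimeTimeLevyArea, PiLp.smul_apply, smul_eq_mul, ← hh, hcoord, hint]
  field_simp
  ring

theorem integral_integral_eq_sub {g : ℝ → ℝ} (hg : Continuous g) (s t : ℝ) :
    ∫ u in s..t, ∫ v in s..u, g v = (t - s) * (∫ u in s..t, g u) - ∫ u in s..t, (u - s) * g u := by
  have hG : Continuous fun u ↦ ∫ v in s..u, g v :=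
    intervalIntegral.continuous_primitive (fun a b ↦ hg.intervalIntegrable a b) s
  have h := intervalIntegral.integral_mul_deriv_eq_deriv_mul (a := s) (b := t)
    (u := fun u ↦ u - s) (v := fun u ↦ ∫ v in s..u, g v) (u' := fun _ ↦ 1) (v' := g)
    (fun x _ ↦ (hasDerivAt_id x).sub_const s)
    (fun x _ ↦ intervalIntegral.integral_hasDerivAt_right (hg.intervalIntegrable _ _)
      (hg.stronglyMeasurableAtFilter _ _) hg.continuousAt)
    (continuous_const.intervalIntegrable _ _) (hg.intervalIntegrable _ _)
  simp only [one_mul, sub_self, zero_mul, sub_zero] at h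
  linarith

end Moments

section WienerPaths

variable {Ω : Type*} {B : ℝ≥0 → Ω → ℝ} {s t : ℝ≥0} {ω : Ω}

theorem wienerIntegral_toNNReal (f f' : ℝ → ℝ) {u : ℝ} (hu : 0 ≤ u) :
    wienerIntegral f f' B s u.toNNReal ω = f u * B u.toNNReal ω - f s * B s ω
      - ∫ v in (s : ℝ)..u, f' v * B v.toNNReal ω := by
  rw [wienerIntegral, Real.coe_toNNReal u hu]

theorem nonneg_of_mem_uIcc {s t : ℝ≥0} {u : ℝ} (hu : u ∈ Set.uIcc (s : ℝ) t) : 0 ≤ u :=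
  (le_min s.2 t.2).trans hu.1

theorem integral_wienerIntegral_one (hω : Continuous fun u : ℝ ↦ B u.toNNReal ω) (s t : ℝ≥0) :
    ∫ u in (s : ℝ)..t, wienerIntegral (fun _ ↦ 1) (fun _ ↦ 0) B s u.toNNReal ω =
      (∫ u in (s : ℝ)..t, B u.toNNReal ω) - ((t : ℝ) - s) * B s ω := by
  rw [← smul_eq_mul, ← intervalIntegral.integral_const,
    ← intervalIntegral.integral_sub (hω.intervalIntegrable _ _)
      (continuous_const.intervalIntegrable _ _)]
  refine intervalIntegral.integral_congr fun u hu ↦ ?_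
  simp [wienerIntegral_toNNReal _ _ (nonneg_of_mem_uIcc hu)]

theorem integral_integral_wienerIntegral_one (hω : Continuous fun u : ℝ ↦ B u.toNNReal ω)
    (s t : ℝ≥0) :
    ∫ u in (s : ℝ)..t, ∫ v in (s : ℝ)..u.toNNReal,
        wienerIntegral (fun _ ↦ 1) (fun _ ↦ 0) B s v.toNNReal ω =
      ((t : ℝ) - s) * (∫ u in (s : ℝ)..t, B u.toNNReal ω)
        - (∫ u in (s : ℝ)..t, (u - s) * B u.toNNReal ω) - ((t : ℝ) - s) ^ 2 / 2 * B s ω := by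
  have hG : Continuous fun u : ℝ ↦ ∫ v in (s : ℝ)..u, B v.toNNReal ω :=
    intervalIntegral.continuous_primitive (fun a b ↦ hω.intervalIntegrable a b) _
  rw [← integral_integral_eq_sub hω, ← integral_sub_left_endpoint,
    ← intervalIntegral.integral_mul_const,
    ← intervalIntegral.integral_sub (hG.intervalIntegrable _ _)
      ((by fun_prop : Continuous fun u : ℝ ↦ (u - s) * B s ω).intervalIntegrable _ _)]
  refine intervalIntegral.integral_congr fun u hu ↦ ?_
  have h := integral_wienerIntegral_one hω s u.toNNReal
  rw [Real.coe_toNNReal u (nonneg_of_mem_uIcc hu)] at h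
  simpa only [Real.coe_toNNReal u (nonneg_of_mem_uIcc hu)] using h

theorem integral_wienerIntegral_sub (hω : Continuous fun u : ℝ ↦ B u.toNNReal ω) (s t : ℝ≥0) :
    ∫ u in (s : ℝ)..t, wienerIntegral (fun u ↦ u - s) (fun _ ↦ 1) B s u.toNNReal ω =
      2 * (∫ u in (s : ℝ)..t, (u - s) * B u.toNNReal ω)
        - ((t : ℝ) - s) * (∫ u in (s : ℝ)..t, B u.toNNReal ω) := by
  have hG : Continuous fun u : ℝ ↦ ∫ v in (s : ℝ)..u, B v.toNNReal ω :=
    intervalIntegral.continuous_primitive (fun a b ↦ hω.intervalIntegrable a b) _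
  have h : ∫ u in (s : ℝ)..t, wienerIntegral (fun u ↦ u - s) (fun _ ↦ 1) B s u.toNNReal ω =
      (∫ u in (s : ℝ)..t, (u - s) * B u.toNNReal ω)
        - ∫ u in (s : ℝ)..t, ∫ v in (s : ℝ)..u, B v.toNNReal ω := by
    have hmul : Continuous fun u : ℝ ↦ (u - s) * B u.toNNReal ω :=
      (continuous_id.sub continuous_const).mul hω
    rw [← intervalIntegral.integral_sub (hmul.intervalIntegrable _ _) (hG.intervalIntegrable _ _)]
    refine intervalIntegral.integral_congr fun u hu ↦ ?_
    simp [wienerIntegral_toNNReal _ _ (nonneg_of_mem_uIcc hu)]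
  rw [h, integral_integral_eq_sub hω]
  ring

end WienerPaths

/-! ### The iterated integrals of length at most three -/

theorem theorem2p4 {Ω : Type*} [MeasurableSpace Ω] {P : Measure Ω} [IsProbabilityMeasure P]
    {d : ℕ} {W : ℝ≥0 → Ω → EuclideanSpace ℝ (Fin d)} (hW : IsStandardBrownianMotion W P)
    {s t : ℝ≥0} (hst : s ≤ t) {h : ℝ} (hh : h = (t : ℝ) - s) (i : Fin d) :
    IteratedIntegralEq P hW.filtration W s t [.space i]
      (fun ω ↦ pathIncrement W s t ω i) ∧
    IteratedIntegralEq P hW.filtration W s t [.space i, .time]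
      (fun ω ↦ 1 / 2 * h * pathIncrement W s t ω i + h * spaceTimeLevyArea W s t ω i) ∧
    IteratedIntegralEq P hW.filtration W s t [.time, .space i]
      (fun ω ↦ 1 / 2 * h * pathIncrement W s t ω i - h * spaceTimeLevyArea W s t ω i) ∧
    IteratedIntegralEq P hW.filtration W s t [.space i, .time, .time]
      (fun ω ↦ 1 / 6 * h ^ 2 * pathIncrement W s t ω i
        + 1 / 2 * h ^ 2 * spaceTimeLevyArea W s t ω i
        + h ^ 2 * spaceTimeTimeLevyArea W s t ω i) ∧
    IteratedIntegralEq P hW.filtration W s t [.time, .space i, .time]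
      (fun ω ↦ 1 / 6 * h ^ 2 * pathIncrement W s t ω i
        - 2 * h ^ 2 * spaceTimeTimeLevyArea W s t ω i) ∧
    IteratedIntegralEq P hW.filtration W s t [.time, .time, .space i]
      (fun ω ↦ 1 / 6 * h ^ 2 * pathIncrement W s t ω i
        - 1 / 2 * h ^ 2 * spaceTimeLevyArea W s t ω i
        + h ^ 2 * spaceTimeTimeLevyArea W s t ω i) := by

  subst hh
  have hB := hW.isBrownianRelativeTo i
  set B : ℝ≥0 → Ω → ℝ := fun t ω ↦ W t ω i
  have hcont : ∀ᵐ ω ∂P, Continuous fun u ↦ W u ω := by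
    filter_upwards [ae_all_iff.2 fun j ↦ (hW.isBrownianReal j).cont] with ω hω
    exact (PiLp.continuous_toLp 2 _).comp (continuous_pi hω)
  have hBω {ω : Ω} (hω : Continuous fun u ↦ W u ω) : Continuous fun u ↦ B u ω := by
    change Continuous fun u ↦ W u ω i
    fun_prop
  have d₀ (x : ℝ) : HasDerivAt (fun _ : ℝ ↦ (1 : ℝ)) 0 x := hasDerivAt_const x 1
  have d₁ (x : ℝ) : HasDerivAt (fun u : ℝ ↦ u - s) 1 x := (hasDerivAt_id x).sub_const _
  have d₂ (x : ℝ) : HasDerivAt (fun u : ℝ ↦ (u - s) ^ 2 / 2) (x - s) x := by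
    simpa using ((d₁ x).fun_pow 2).div_const 2
  have c₁ : Continuous fun u : ℝ ↦ u - s := by fun_prop
  have hT : HasIteratedIntegralRev P hW.filtration W s [.time] fun u _ ↦ (u : ℝ) - s :=
    (HasIteratedIntegralRev.nil.cons_time (ae_of_all _ fun _ ↦ continuous_const)).congr
      (ae_of_all _ fun ω t _ ↦ by simp)
  have hTT : HasIteratedIntegralRev P hW.filtration W s [.time, .time]
      fun u _ ↦ ((u : ℝ) - s) ^ 2 / 2 := by
    refine (hT.cons_time (ae_of_all _ fun _ ↦ by fun_prop)).congr (ae_of_all _ fun ω t _ ↦ ?_)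
    rw [← integral_sub_left_endpoint]
    refine intervalIntegral.integral_congr fun u hu ↦ ?_
    simp only [Real.coe_toNNReal u (nonneg_of_mem_uIcc hu)]
  -- The words are read with the outermost integrator first, so that `hST` is `∫∫ dv dW_u`.
  have hS := HasIteratedIntegralRev.nil.cons_space (s := s) hB d₀ continuous_const
  have hST := hT.cons_space hB d₁ continuous_const
  have hSTT := hTT.cons_space hB d₂ c₁
  have hTS := hS.cons_time (hcont.mono fun ω hω ↦
    continuous_wienerIntegral continuous_const continuous_const (hBω hω))
  have hTST := hST.cons_time (hcont.mono fun ω hω ↦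
    continuous_wienerIntegral c₁ continuous_const (hBω hω))
  have hTTS := hTS.cons_time (hcont.mono fun ω hω ↦
    (intervalIntegral.continuous_primitive (fun a b ↦
      ((continuous_wienerIntegral continuous_const continuous_const (hBω hω)).comp
        continuous_real_toNNReal).intervalIntegrable a b) (s : ℝ)).comp NNReal.continuous_coe)
  refine ⟨hS.iteratedIntegralEq hst ?_, hTS.iteratedIntegralEq hst ?_,
    hST.iteratedIntegralEq hst ?_, hTTS.iteratedIntegralEq hst ?_,
    hTST.iteratedIntegralEq hst ?_, hSTT.iteratedIntegralEq hst ?_⟩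
  all_goals
    filter_upwards [hcont] with ω hω
    have hH := mul_spaceTimeLevyArea_apply hω s t i
    have hK := sq_mul_spaceTimeTimeLevyArea_apply hω s t i
    have hBr := continuous_path_toNNReal hω i
    simp only [pathIncrement, PiLp.sub_apply]
  · simp [wienerIntegral]
  · rw [integral_wienerIntegral_one hBr, hH]
    ring
  · rw [hH]
    simp [wienerIntegral]
    ring
  · rw [integral_integral_wienerIntegral_one hBr, hK]
    linear_combination (-1 / 2 * ((t : ℝ) - s)) * hH
  · rw [integral_wienerIntegral_sub hBr]
    linear_combination 2 * hK
  · simp only [wienerIntegral]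
    rw [hK]
    linear_combination (1 / 2 * ((t : ℝ) - s)) * hH
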